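/- Let $X$ be a nonempty set. A function $d:X\times X\to[0,\infty)$ is a quasi-metric if there are $C_0,C_1\in(0,\infty)$ such that $d(x,y)=0\iff x=y$, $d(y,x)\le C_0\,d(x,y)$ and $d(x,y)\le C_1\max\{d(x,z),d(z,y)\}$ for all $x,y,z\in X$. Put $B_d(x,r)=\{y\in X:d(x,y)<r\}$; a set is open in the topology $\tau_d$ if it contains, with each of its points $x$, a ball $B_d(x,r)$, $r>0$. Quasi-metrics $d,\varrho$ are equivalent, $d\approx\varrho$, if $\kappa^{-1}\varrho\le d\le\kappa\varrho$ for some $\kappa\in(0,\infty)$. $(X,d)$ is totally bounded if for every $\varepsilon>0$ finitely many balls $B_d(x_i,\varepsilon)$ cover $X$. $(X,d,\mu)$ is a quasi-metric-measure space if $d$ is a quasi-metric and $\mu$ is a nonnegative measure, on a $\sigma$-algebra containing the Borel sets of $\tau_d$, such that all balls $B_d(x,r)$ are measurable and $0<\mu(B_d(x,r))<\infty$ for all $x\in X$, $r\in(0,\infty)$. For $\alpha\in(0,\infty)$ and a measurable $u:X\to\mathbb R$, an $\alpha$-fractional gradient of $u$ is a sequence $\vec g=(g_k)_{k\in\mathbb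 Z}$ of measurable functions $g_k:X\to[0,\infty]$ for which there is a measurable set $E$ with $\mu(E)=0$ and $$|u(x)-u(y)|\le d(x,y)^\alpha\,(g_k(x)+g_k(y))$$ for all $k\in\mathbb Z$ and $x,y\in X\setminus E$ with $2^{-k-1}\le d(x,y)<2^{-k}$. A measurable $g:X\to[0,\infty]$ is an $\alpha$-gradient of $u$ if, for some measurable $E$ with $\mu(E)=0$, $|u(x)-u(y)|\le d(x,y)^\alpha(g(x)+g(y))$ for all $x,y\in X\setminus E$. For $p\in(0,\infty)$ and $q\in(0,\infty]$ let $M^\alpha_{p,q}(X,d,\mu)$, $N^\alpha_{p,q}(X,d,\mu)$ and $M^{\alpha,p}(X,d,\mu)$ be the spaces of all measurable $u\in L^p(X,\mu)$ for which, respectively, $$\inf_{\vec g}\big\|\,\|(g_k)_k\|_{\ell^q(\mathbb Z)}\big\|_{L^p(X,\mu)},\qquad \inf_{\vec g}\big\|(\|g_k\|_{L^p(X,\mu)})_k\big\|_{\ell^q(\mathbb Z)},\qquad \inf_{g}\|g\|_{L^p(X,\mu)}$$ is finite (infima over all $\alpha$-fractional gradients $\vec g$, respectively all $\alpha$-gradients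 $g$, of $u$), with the quasi-norm given by the sum of $\|u\|_{L^p(X,\mu)}$ and this infimum. A continuous embedding of such a space into $L^p(X,\nu)$ is compact if every bounded sequence has a subsequence that converges in $L^p(X,\nu)$. **Theorem.** Let $(X,d,\mu)$ be a quasi-metric-measure space and let $\nu$ be a measure (on the same $\sigma$-algebra) with $\nu\le C\mu$ for some constant $C\in(0,\infty)$. Suppose that $\mu$ is $\nu$-integrable, i.e. there is a quasi-metric $\varrho\approx d$ on $X$ such that, for each $r\in(0,\infty)$, all balls $B_\varrho(x,r)$ are measurable, the map $x\mapsto\mu(B_\varrho(x,r))$ is measurable, and $$\int_X\frac{1}{\mu(B_\varrho(x,r))}\,d\nu(x)<\infty .$$ Then, for all $\alpha,p\in(0,\infty)$ and $q\in(0,\infty]$, the embeddings $$M^\alpha_{p,q}(X,d,\mu)\hookrightarrow L^p(X,\nu),\qquad N^\alpha_{p,q}(X,d,\mu)\hookrightarrow L^p(X,\nu),\qquad M^{\alpha,p}(X,d,\mu)\hookrightarrow L^p(X,\nu)$$ are well defined, continuous and compact. In particular, these embeddings are compact whenever $(X,d)$ is totally bounded. -/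

import Mathlib

open MeasureTheory Filter Topology
open scoped ENNReal NNReal

/-- `d` is a quasi-metric on `X`. -/
structure IsQuasiMetric {X : Type*} (d : X → X → ℝ) : Prop where
  nonneg : ∀ x y, 0 ≤ d x y
  eq_zero_iff : ∀ x y, d x y = 0 ↔ x = y
  quasi_symm : ∃ C₀ : ℝ, 0 < C₀ ∧ ∀ x y, d y x ≤ C₀ * d x y
  quasi_triangle : ∃ C₁ : ℝ, 0 < C₁ ∧ ∀ x y z, d x y ≤ C₁ * max (d x z) (d z y)

/-- Equivalence `d ≈ ρ` of two quasi-metrics. -/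
def QuasiMetricEquiv {X : Type*} (d ρ : X → X → ℝ) : Prop :=
  ∃ κ : ℝ, 0 < κ ∧ ∀ x y, κ⁻¹ * ρ x y ≤ d x y ∧ d x y ≤ κ * ρ x y

/-- The ball `B_d(x, r) = {y : d(x, y) < r}`; the centre is the first argument of `d`. -/
def quasiBall {X : Type*} (d : X → X → ℝ) (x : X) (r : ℝ) : Set X := {y | d x y < r}

/-- The topology `τ_d`: a set is open if it contains a ball around each of its points. -/
@[reducible] def quasiTopology {X : Type*} (d : X → X → ℝ) : TopologicalSpace X where
  IsOpen O := ∀ x ∈ O, ∃ r : ℝ, 0 < r ∧ quasiBall d x r ⊆ O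
  isOpen_univ := fun _ _ => ⟨1, one_pos, Set.subset_univ _⟩
  isOpen_inter := by
    intro s t hs ht x hx
    obtain ⟨r₁, h₁, hs'⟩ := hs x hx.1
    obtain ⟨r₂, h₂, ht'⟩ := ht x hx.2
    refine ⟨min r₁ r₂, lt_min h₁ h₂, fun y hy => ⟨hs' ?_, ht' ?_⟩⟩
    · exact lt_of_lt_of_le (show d x y < min r₁ r₂ from hy) (min_le_left _ _)
    · exact lt_of_lt_of_le (show d x y < min r₁ r₂ from hy) (min_le_right _ _)
  isOpen_sUnion := by
    intro S hS x hx
    obtain ⟨s, hs, hxs⟩ := hx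
    obtain ⟨r, hr, hsub⟩ := hS s hs x hxs
    exact ⟨r, hr, hsub.trans (Set.subset_sUnion_of_mem hs)⟩

/-- Total boundedness of `(X, d)`: finite `ε`-nets for all `ε > 0`. -/
def QuasiTotallyBounded {X : Type*} (d : X → X → ℝ) : Prop :=
  ∀ ε : ℝ, 0 < ε → ∃ t : Set X, t.Finite ∧ ∀ x, ∃ y ∈ t, x ∈ quasiBall d y ε

/-- `(X, d, μ)` is a quasi-metric-measure space. The sigma-algebra on which `μ` is defined
contains the Borel sets of `τ_d` and all balls, but may be larger. -/
structure IsQuasiMetricMeasureSpace {X : Type*} [mX : MeasurableSpace X]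
    (d : X → X → ℝ) (μ : Measure X) : Prop where
  isQuasiMetric : IsQuasiMetric d
  borel_le : @borel X (quasiTopology d) ≤ mX
  measurableSet_ball : ∀ x r, 0 < r → MeasurableSet (quasiBall d x r)
  ball_pos : ∀ x r, 0 < r → 0 < μ (quasiBall d x r)
  ball_lt_top : ∀ x r, 0 < r → μ (quasiBall d x r) < ∞

/-- `μ` is `ν`-integrable on `(X, d)`. -/
def IsIntegrableMeasure {X : Type*} [MeasurableSpace X]
    (d : X → X → ℝ) (μ ν : Measure X) : Prop :=
  ∃ ρ : X → X → ℝ, IsQuasiMetric ρ ∧ QuasiMetricEquiv d ρ ∧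
    (∀ x r, 0 < r → MeasurableSet (quasiBall ρ x r)) ∧
    ∀ r, 0 < r → Measurable (fun x => μ (quasiBall ρ x r)) ∧
      ∫⁻ x, (μ (quasiBall ρ x r))⁻¹ ∂ν < ∞

/-- The `ℓ^q(ℤ)` quasi-norm of a nonnegative sequence, `0 < q ≤ ∞`. -/
noncomputable def lqNorm (q : ℝ≥0∞) (a : ℤ → ℝ≥0∞) : ℝ≥0∞ :=
  if q = ∞ then ⨆ k, a k else (∑' k, a k ^ q.toReal) ^ (1 / q.toReal)

/-- `g = (g_k)` is an `α`-fractional gradient of `u`. -/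
def IsFractionalGradient {X : Type*} [MeasurableSpace X] (d : X → X → ℝ) (μ : Measure X)
    (α : ℝ) (u : X → ℝ) (g : ℤ → X → ℝ≥0∞) : Prop :=
  (∀ k, Measurable (g k)) ∧
  ∃ E : Set X, MeasurableSet E ∧ μ E = 0 ∧
    ∀ k : ℤ, ∀ x ∉ E, ∀ y ∉ E, (2 : ℝ) ^ (-k - 1) ≤ d x y → d x y < (2 : ℝ) ^ (-k) →
      ENNReal.ofReal |u x - u y| ≤ ENNReal.ofReal (d x y ^ α) * (g k x + g k y)

/-- `g` is an `α`-gradient of `u`. -/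
def IsHajlaszGradient {X : Type*} [MeasurableSpace X] (d : X → X → ℝ) (μ : Measure X)
    (α : ℝ) (u : X → ℝ) (g : X → ℝ≥0∞) : Prop :=
  Measurable g ∧
  ∃ E : Set X, MeasurableSet E ∧ μ E = 0 ∧
    ∀ x ∉ E, ∀ y ∉ E,
      ENNReal.ofReal |u x - u y| ≤ ENNReal.ofReal (d x y ^ α) * (g x + g y)

/-- The homogeneous Hajlasz–Triebel–Lizorkin semi-norm, with value `∞` off the space. -/
noncomputable def homTriebelLizorkinNorm {X : Type*} [MeasurableSpace X] (d : X → X → ℝ)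
    (μ : Measure X) (α : ℝ) (p q : ℝ≥0∞) (u : X → ℝ) : ℝ≥0∞ :=
  ⨅ (g : ℤ → X → ℝ≥0∞) (_ : IsFractionalGradient d μ α u g),
    eLpNorm (fun x => lqNorm q (fun k => g k x)) p μ

/-- The homogeneous Hajlasz–Besov semi-norm, with value `∞` off the space. -/
noncomputable def homBesovNorm {X : Type*} [MeasurableSpace X] (d : X → X → ℝ)
    (μ : Measure X) (α : ℝ) (p q : ℝ≥0∞) (u : X → ℝ) : ℝ≥0∞ :=
  ⨅ (g : ℤ → X → ℝ≥0∞) (_ : IsFractionalGradient d μ α u g),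
    lqNorm q (fun k => eLpNorm (g k) p μ)

/-- The homogeneous Hajlasz–Sobolev semi-norm, with value `∞` off the space. -/
noncomputable def homHajlaszSobolevNorm {X : Type*} [MeasurableSpace X] (d : X → X → ℝ)
    (μ : Measure X) (α : ℝ) (p : ℝ≥0∞) (u : X → ℝ) : ℝ≥0∞ :=
  ⨅ (g : X → ℝ≥0∞) (_ : IsHajlaszGradient d μ α u g), eLpNorm g p μ

/-- Given a homogeneous semi-norm `H`, the functions of the corresponding inhomogeneous space:
the measurable `u` in `L^p(X, μ)` with `H u < ∞`. -/
def inhomSpace {X : Type*} [MeasurableSpace X] (μ : Measure X) (p : ℝ≥0∞)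
    (H : (X → ℝ) → ℝ≥0∞) : Set (X → ℝ) :=
  {u | Measurable u ∧ MemLp u p μ ∧ H u < ∞}

/-- The inhomogeneous quasi-norm `‖u‖_{L^p(X, μ)} + H u`. -/
noncomputable def inhomNorm {X : Type*} [MeasurableSpace X] (μ : Measure X) (p : ℝ≥0∞)
    (H : (X → ℝ) → ℝ≥0∞) (u : X → ℝ) : ℝ≥0∞ :=
  eLpNorm u p μ + H u

/-- The space `S` of functions with quasi-norm `N` embeds compactly into `L^p(X, ν)`: the identity
is well defined and bounded, and every `N`-bounded sequence in `S` has a subsequence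
that converges in `L^p(X, ν)`. (For `p < 1` there is no topology on Mathlib's `Lp`, so convergence
is expressed through `eLpNorm`.) -/
def IsCompactlyEmbeddedInLp {X : Type*} [MeasurableSpace X] (S : Set (X → ℝ))
    (N : (X → ℝ) → ℝ≥0∞) (p : ℝ≥0∞) (ν : Measure X) : Prop :=
  (∀ u ∈ S, MemLp u p ν) ∧
  (∃ K : ℝ≥0, ∀ u ∈ S, eLpNorm u p ν ≤ K * N u) ∧
  ∀ u : ℕ → X → ℝ, (∀ n, u n ∈ S) → (∃ M : ℝ≥0, ∀ n, N (u n) ≤ M) →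
    ∃ f : X → ℝ, MemLp f p ν ∧ ∃ φ : ℕ → ℕ, StrictMono φ ∧
      Tendsto (fun n => eLpNorm (u (φ n) - f) p ν) atTop (𝓝 0)

/-- `M^α_{p,q}(X, d, μ)` embeds compactly into `L^p(X, ν)`. -/
def TriebelLizorkinCompactlyEmbeds {X : Type*} [MeasurableSpace X] (d : X → X → ℝ)
    (μ ν : Measure X) (α : ℝ) (p q : ℝ≥0∞) : Prop :=
  IsCompactlyEmbeddedInLp (inhomSpace μ p (homTriebelLizorkinNorm d μ α p q))
    (inhomNorm μ p (homTriebelLizorkinNorm d μ α p q)) p ν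

/-- `N^α_{p,q}(X, d, μ)` embeds compactly into `L^p(X, ν)`. -/
def BesovCompactlyEmbeds {X : Type*} [MeasurableSpace X] (d : X → X → ℝ)
    (μ ν : Measure X) (α : ℝ) (p q : ℝ≥0∞) : Prop :=
  IsCompactlyEmbeddedInLp (inhomSpace μ p (homBesovNorm d μ α p q))
    (inhomNorm μ p (homBesovNorm d μ α p q)) p ν

/-- `M^{α,p}(X, d, μ)` embeds compactly into `L^p(X, ν)`. -/
def HajlaszSobolevCompactlyEmbeds {X : Type*} [MeasurableSpace X] (d : X → X → ℝ)
    (μ ν : Measure X) (α : ℝ) (p : ℝ≥0∞) : Prop :=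
  IsCompactlyEmbeddedInLp (inhomSpace μ p (homHajlaszSobolevNorm d μ α p))
    (inhomNorm μ p (homHajlaszSobolevNorm d μ α p)) p ν

/-!
Suppose that, off a `μ`-null set, `|u x - u y| ≤ h x + h y` whenever `d x y < r`, and that
`∫ h ^ p dμ` is small. On each cell of a countable partition of `X` into measurable cells in which
all distances are smaller than `r`, comparing `u` with its value at a point where `h ^ p` does not
exceed its mean over the cell shows that `u` is close in `L^p(μ)`, hence in `L^p(ν)`, to a function
constant on the cells. Comparing `u x` in the same way with the value of `u` at a suitable point of
`B_d(x, r)` bounds `|u x| ^ p` by `h x ^ p` plus a constant times `1 / μ(B_d(x, r))`. Since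
`1 / μ(B_d(x, r))` is `ν`-integrable, all but finitely many cells contribute little to the
`L^p(ν)` norm, uniformly over a bounded family of functions `u`. Such a family is therefore, up to
a small error, a bounded family of step functions over finitely many fixed cells.

A fractional gradient `g` supplies `h = sup_{k ≥ n} 2 ^ (-k α) g_k` with `r = 2 ^ (-n)`, and a
geometric series bounds `∫ h ^ p dμ` by a multiple of `2 ^ (-n α p) sup_k ∫ g_k ^ p dμ`. This is the
case of `N^α_{p,∞}`, into which the other spaces embed.
-/

section LintegralRpow

variable {X E : Type*} [MeasurableSpace X] {ν : Measure X} [NormedAddCommGroup E] {t : ℝ}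

theorem add_rpow_le_two_rpow_mul (a b : ℝ≥0∞) (ht : 0 ≤ t) :
    (a + b) ^ t ≤ 2 ^ t * (a ^ t + b ^ t) :=
  calc (a + b) ^ t ≤ (2 * max a b) ^ t := by
        rw [two_mul]
        exact ENNReal.rpow_le_rpow (add_le_add (le_max_left a b) (le_max_right a b)) ht
    _ = 2 ^ t * max (a ^ t) (b ^ t) := by
        rw [ENNReal.mul_rpow_of_nonneg _ _ ht, (ENNReal.monotone_rpow_of_nonneg ht).map_max]
    _ ≤ 2 ^ t * (a ^ t + b ^ t) := by gcongr; exact max_le_add_of_nonneg zero_le zero_le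

theorem enorm_sub_rpow_le_two_rpow_mul (a b c : E) (ht : 0 ≤ t) :
    ‖a - c‖ₑ ^ t ≤ 2 ^ t * (‖a - b‖ₑ ^ t + ‖b - c‖ₑ ^ t) := by
  rw [← sub_add_sub_cancel a b c]
  exact (ENNReal.rpow_le_rpow (enorm_add_le _ _) ht).trans (add_rpow_le_two_rpow_mul _ _ ht)

theorem lintegral_enorm_sub_rpow_le_two_rpow_mul {f g : X → E} (ht : 0 ≤ t)
    (hfg : AEStronglyMeasurable (fun x => f x - g x) ν) (h : X → E) :
    ∫⁻ x, ‖f x - h x‖ₑ ^ t ∂ν ≤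
      2 ^ t * (∫⁻ x, ‖f x - g x‖ₑ ^ t ∂ν + ∫⁻ x, ‖g x - h x‖ₑ ^ t ∂ν) :=
  calc ∫⁻ x, ‖f x - h x‖ₑ ^ t ∂ν
      ≤ ∫⁻ x, 2 ^ t * (‖f x - g x‖ₑ ^ t + ‖g x - h x‖ₑ ^ t) ∂ν :=
        lintegral_mono fun x => enorm_sub_rpow_le_two_rpow_mul _ _ _ ht
    _ = 2 ^ t * (∫⁻ x, ‖f x - g x‖ₑ ^ t ∂ν + ∫⁻ x, ‖g x - h x‖ₑ ^ t ∂ν) := by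
        rw [lintegral_const_mul' _ _ (by finiteness), lintegral_add_left' (hfg.enorm.pow_const t)]

theorem lintegral_enorm_sub_rpow_le_of_ae_tendsto {f g : X → E} {v : ℕ → X → E} {ε : ℝ≥0∞}
    (hg : AEStronglyMeasurable g ν) (hv : ∀ k, AEStronglyMeasurable (v k) ν)
    (hlim : ∀ᵐ x ∂ν, Tendsto (fun k => v k x) atTop (𝓝 (f x)))
    (hle : ∀ᶠ k in atTop, ∫⁻ x, ‖g x - v k x‖ₑ ^ t ∂ν ≤ ε) :
    ∫⁻ x, ‖g x - f x‖ₑ ^ t ∂ν ≤ ε :=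
  calc ∫⁻ x, ‖g x - f x‖ₑ ^ t ∂ν
      = ∫⁻ x, liminf (fun k => ‖g x - v k x‖ₑ ^ t) atTop ∂ν := by
        refine lintegral_congr_ae (hlim.mono fun x hx => (Tendsto.liminf_eq ?_).symm)
        exact (hx.const_sub (g x)).enorm.ennrpow_const t
    _ ≤ liminf (fun k => ∫⁻ x, ‖g x - v k x‖ₑ ^ t ∂ν) atTop :=
        lintegral_liminf_le' fun k => (hg.sub (hv k)).enorm.pow_const t
    _ ≤ ε := liminf_le_of_frequently_le' hle.frequently

variable [CompleteSpace E]

theorem ae_exists_tendsto_of_lintegral_enorm_sub_succ_rpow_le {v : ℕ → X → E} (ht : 0 < t)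
    (hv : ∀ k, AEStronglyMeasurable (v k) ν)
    (hle : ∀ k, ∫⁻ x, ‖v k x - v (k + 1) x‖ₑ ^ t ∂ν ≤ (2⁻¹ ^ k) ^ t * 2⁻¹ ^ k) :
    ∀ᵐ x ∂ν, ∃ l, Tendsto (fun k => v k x) atTop (𝓝 l) := by
  have hb0 : ∀ k : ℕ, ((2⁻¹ : ℝ≥0∞) ^ k) ^ t ≠ 0 := fun k =>
    (ENNReal.rpow_pos (ENNReal.pow_pos (by simp) k) (by finiteness)).ne'
  have chebyshev : ∀ k, ν {x | (2⁻¹ ^ k) ^ t ≤ ‖v k x - v (k + 1) x‖ₑ ^ t} ≤ 2⁻¹ ^ k := fun k => by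
    refine (meas_ge_le_lintegral_div (((hv k).sub (hv _)).enorm.pow_const t) (hb0 k)
      (by finiteness)).trans ?_
    rw [ENNReal.div_le_iff (hb0 k) (by finiteness), mul_comm]
    exact hle k
  have summable : ∑' k, ν {x | (2⁻¹ ^ k) ^ t ≤ ‖v k x - v (k + 1) x‖ₑ ^ t} ≠ ∞ := by
    refine ne_top_of_le_ne_top ?_ (ENNReal.tsum_le_tsum chebyshev)
    simp [ENNReal.tsum_geometric]
  filter_upwards [ae_eventually_notMem summable] with x hx
  obtain ⟨K, hK⟩ := eventually_atTop.1 hx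
  suffices CauchySeq fun k => v (k + K) x by
    obtain ⟨l, hl⟩ := cauchySeq_tendsto_of_complete this
    exact ⟨l, (tendsto_add_atTop_iff_nat K).1 hl⟩
  refine cauchySeq_of_edist_le_geometric_two 1 ENNReal.one_ne_top fun k => ?_
  have hlt : ‖v (k + K) x - v (k + K + 1) x‖ₑ < 2⁻¹ ^ (k + K) :=
    (ENNReal.rpow_lt_rpow_iff ht).1 (not_le.1 (hK (k + K) le_add_self))
  rw [edist_eq_enorm_sub, add_right_comm, one_div, ENNReal.inv_pow]
  exact hlt.le.trans (pow_le_pow_of_le_one zero_le (by simp) le_self_add)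

/-- Mathlib's completeness theorem for `L^p` assumes `1 ≤ p`. -/
theorem exists_tendsto_lintegral_enorm_sub_rpow_of_cauchy {u : ℕ → X → E} (ht : 0 < t)
    (hu : ∀ n, AEStronglyMeasurable (u n) ν)
    (hc : ∀ ε : ℝ≥0∞, 0 < ε → ∃ N, ∀ m ≥ N, ∀ n ≥ N, ∫⁻ x, ‖u m x - u n x‖ₑ ^ t ∂ν ≤ ε) :
    ∃ f : X → E, StronglyMeasurable f ∧
      Tendsto (fun n => ∫⁻ x, ‖u n x - f x‖ₑ ^ t ∂ν) atTop (𝓝 0) := by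
  obtain ⟨φ, hφ, hle⟩ : ∃ φ : ℕ → ℕ, StrictMono φ ∧ ∀ k, ∀ n ≥ φ k,
      ∫⁻ x, ‖u (φ k) x - u n x‖ₑ ^ t ∂ν ≤ (2⁻¹ ^ k) ^ t * 2⁻¹ ^ k := by
    refine extraction_forall_of_eventually' (P := fun k m => ∀ n ≥ m,
      ∫⁻ x, ‖u m x - u n x‖ₑ ^ t ∂ν ≤ (2⁻¹ ^ k) ^ t * 2⁻¹ ^ k) fun k => ?_
    have hpow : 0 < (2⁻¹ : ℝ≥0∞) ^ k := ENNReal.pow_pos (by simp) k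
    obtain ⟨N, hN⟩ := hc ((2⁻¹ ^ k) ^ t * 2⁻¹ ^ k) <| ENNReal.mul_pos
      (ENNReal.rpow_pos hpow (by finiteness)).ne' hpow.ne'
    exact ⟨N, fun m hm n hn => hN m hm n (hm.trans hn)⟩
  obtain ⟨f, hf, hlim⟩ := exists_stronglyMeasurable_limit_of_tendsto_ae (fun k => hu (φ k)) <|
    ae_exists_tendsto_of_lintegral_enorm_sub_succ_rpow_le ht (fun k => hu (φ k))
      fun k => hle k _ (hφ k.lt_succ_self).le
  refine ⟨f, hf, ENNReal.tendsto_nhds_zero.2 fun ε hε => ?_⟩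
  obtain ⟨N, hN⟩ := hc ε hε
  filter_upwards [eventually_ge_atTop N] with n hn
  refine lintegral_enorm_sub_rpow_le_of_ae_tendsto (hu n) (fun k => hu (φ k)) hlim ?_
  filter_upwards [eventually_ge_atTop N] with k hk
  exact hN n hn _ (hk.trans (hφ.id_le k))

theorem exists_tendsto_lintegral_enorm_sub_rpow_of_eventually_le {u : ℕ → X → E} (ht : 0 < t)
    (hu : ∀ n, AEStronglyMeasurable (u n) ν)
    (hnear : ∀ ε : ℝ≥0∞, 0 < ε → ∃ v : X → E, AEStronglyMeasurable v ν ∧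
      ∀ᶠ n in atTop, ∫⁻ x, ‖u n x - v x‖ₑ ^ t ∂ν ≤ ε) :
    ∃ f : X → E, StronglyMeasurable f ∧
      Tendsto (fun n => ∫⁻ x, ‖u n x - f x‖ₑ ^ t ∂ν) atTop (𝓝 0) := by
  refine exists_tendsto_lintegral_enorm_sub_rpow_of_cauchy ht hu fun ε hε => ?_
  obtain ⟨v, hv, hle⟩ := hnear (ε / (2 ^ t * 2)) (ENNReal.div_pos hε.ne' (by finiteness))
  obtain ⟨N, hN⟩ := eventually_atTop.1 hle
  refine ⟨N, fun m hm n hn => ?_⟩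
  calc ∫⁻ x, ‖u m x - u n x‖ₑ ^ t ∂ν
      ≤ 2 ^ t * (∫⁻ x, ‖u m x - v x‖ₑ ^ t ∂ν + ∫⁻ x, ‖v x - u n x‖ₑ ^ t ∂ν) :=
        lintegral_enorm_sub_rpow_le_two_rpow_mul ht.le ((hu m).sub hv) _
    _ ≤ 2 ^ t * (ε / (2 ^ t * 2) + ε / (2 ^ t * 2)) := by
        gcongr
        · exact hN m hm
        · simpa only [enorm_sub_rev] using hN n hn
    _ = 2 ^ t * 2 * (ε / (2 ^ t * 2)) := by ring
    _ ≤ ε := ENNReal.mul_div_le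

end LintegralRpow

section StepApproximation

variable {X E ι : Type*} [MeasurableSpace X] {ν : Measure X} [NormedAddCommGroup E] {t : ℝ}

/-- Up to an error `ε` in `L^t(ν)`, all functions of the family `u` are step functions `c ∘ π` over
one index map `π : X → ℕ`, with values dominated by one function `b ∘ π` in `L^t(ν)`. -/
def HasDominatedStepApprox (ν : Measure X) (t : ℝ) (u : ι → X → E) (ε : ℝ≥0∞) : Prop :=
  ∃ π : X → ℕ, Measurable π ∧ ∃ b : ℕ → ℝ≥0, ∫⁻ x, (b (π x) : ℝ≥0∞) ^ t ∂ν ≠ ∞ ∧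
    ∀ n, ∃ c : ℕ → E, (∀ i, ‖c i‖ₑ ≤ b i) ∧ ∫⁻ x, ‖u n x - c (π x)‖ₑ ^ t ∂ν ≤ ε

theorem stronglyMeasurable_comp_nat {π : X → ℕ} (hπ : Measurable π) (c : ℕ → E) :
    StronglyMeasurable fun x => c (π x) :=
  (StronglyMeasurable.of_discrete (f := c)).comp_measurable hπ

theorem tendsto_lintegral_enorm_step_sub_rpow {π : X → ℕ} (hπ : Measurable π) {b : ℕ → ℝ≥0}
    (hb : ∫⁻ x, (b (π x) : ℝ≥0∞) ^ t ∂ν ≠ ∞) (ht : 0 < t) {c : ℕ → ℕ → E} {a : ℕ → E}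
    (hcb : ∀ n i, ‖c n i‖ₑ ≤ b i) (hca : ∀ i, Tendsto (fun n => c n i) atTop (𝓝 (a i))) :
    Tendsto (fun n => ∫⁻ x, ‖c n (π x) - a (π x)‖ₑ ^ t ∂ν) atTop (𝓝 0) := by
  have hbound : ∀ n i, ‖c n i - a i‖ₑ ^ t ≤ 2 ^ t * (b i : ℝ≥0∞) ^ t := fun n i => by
    have hab : ‖a i‖ₑ ≤ b i := le_of_tendsto' (hca i).enorm fun n => hcb n i
    rw [← ENNReal.mul_rpow_of_nonneg _ _ ht.le, two_mul]
    exact ENNReal.rpow_le_rpow (enorm_sub_le.trans (add_le_add (hcb n i) hab)) ht.le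
  have hzero : ∀ i, Tendsto (fun n => ‖c n i - a i‖ₑ ^ t) atTop (𝓝 0) := fun i => by
    simpa [ENNReal.zero_rpow_of_pos ht] using
      ((hca i).sub_const (a i)).enorm.ennrpow_const t
  rw [← lintegral_zero (μ := ν)]
  refine tendsto_lintegral_of_dominated_convergence' _
    (fun n => ((stronglyMeasurable_comp_nat hπ (c n - a)).enorm.pow_const t).aemeasurable)
    (fun n => ae_of_all _ fun x => hbound n (π x)) ?_ (ae_of_all _ fun x => hzero (π x))
  rw [lintegral_const_mul' _ _ (by finiteness)]
  exact ENNReal.mul_ne_top (by finiteness) hb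

theorem exists_subseq_forall_tendsto_of_enorm_le {κ : Type*} [Countable κ] [ProperSpace E]
    {b : κ → ℝ≥0} {c : ℕ → κ → E} (hcb : ∀ n i, ‖c n i‖ₑ ≤ b i) :
    ∃ a : κ → E, ∃ φ : ℕ → ℕ, StrictMono φ ∧
      ∀ i, Tendsto (fun n => c (φ n) i) atTop (𝓝 (a i)) := by
  have hcompact : IsCompact (Set.univ.pi fun i => Metric.closedBall (0 : E) (b i)) :=
    isCompact_univ_pi fun i => isCompact_closedBall 0 (b i)
  obtain ⟨a, -, φ, hφ, hlim⟩ := hcompact.tendsto_subseq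
    fun n i _ => mem_closedBall_zero_iff.2 (enorm_le_coe.1 (hcb n i))
  exact ⟨a, φ, hφ, tendsto_pi_nhds.1 hlim⟩

theorem exists_subseq_tendsto_of_hasDominatedStepApprox [ProperSpace E] {u : ℕ → X → E}
    (ht : 0 < t) (hu : ∀ n, AEStronglyMeasurable (u n) ν)
    (happrox : ∀ ε : ℝ≥0∞, 0 < ε → HasDominatedStepApprox ν t u ε) :
    ∃ φ : ℕ → ℕ, StrictMono φ ∧ ∃ f : X → E, StronglyMeasurable f ∧
      Tendsto (fun n => ∫⁻ x, ‖u (φ n) x - f x‖ₑ ^ t ∂ν) atTop (𝓝 0) := by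
  choose π hπ b hb c hcb hc using fun k : ℕ =>
    happrox (k : ℝ≥0∞)⁻¹ (ENNReal.inv_pos.2 (ENNReal.natCast_ne_top k))
  obtain ⟨a, φ, hφ, hlim⟩ := exists_subseq_forall_tendsto_of_enorm_le
    (c := fun n (ki : ℕ × ℕ) => c ki.1 n ki.2) fun n ki => hcb ki.1 n ki.2
  refine ⟨φ, hφ, exists_tendsto_lintegral_enorm_sub_rpow_of_eventually_le ht (fun n => hu (φ n))
    fun ε hε => ?_⟩
  obtain ⟨k, hk⟩ := ENNReal.exists_inv_nat_lt
    (ENNReal.div_pos hε.ne' (by finiteness : (2 : ℝ≥0∞) ^ t * 2 ≠ ∞)).ne'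
  have hstep := tendsto_lintegral_enorm_step_sub_rpow (hπ k) (hb k) ht (a := fun i => a (k, i))
    (fun n => hcb k (φ n)) fun i => hlim (k, i)
  refine ⟨fun x => a (k, π k x),
    (stronglyMeasurable_comp_nat (hπ k) fun i => a (k, i)).aestronglyMeasurable, ?_⟩
  filter_upwards [ENNReal.tendsto_nhds_zero.1 hstep (k : ℝ≥0∞)⁻¹ (by simp)] with n hn
  calc ∫⁻ x, ‖u (φ n) x - a (k, π k x)‖ₑ ^ t ∂ν
      ≤ 2 ^ t * (∫⁻ x, ‖u (φ n) x - c k (φ n) (π k x)‖ₑ ^ t ∂ν +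
          ∫⁻ x, ‖c k (φ n) (π k x) - a (k, π k x)‖ₑ ^ t ∂ν) :=
        lintegral_enorm_sub_rpow_le_two_rpow_mul ht.le ((hu _).sub
          (stronglyMeasurable_comp_nat (hπ k) _).aestronglyMeasurable) _
    _ ≤ 2 ^ t * ((k : ℝ≥0∞)⁻¹ + (k : ℝ≥0∞)⁻¹) := by gcongr; exact hc k (φ n)
    _ = 2 ^ t * 2 * (k : ℝ≥0∞)⁻¹ := by ring
    _ ≤ 2 ^ t * 2 * (ε / (2 ^ t * 2)) := by gcongr
    _ ≤ ε := ENNReal.mul_div_le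

end StepApproximation

section Oscillation

variable {X E : Type*} [MeasurableSpace X] {μ ν : Measure X} {t : ℝ}

theorem lintegral_eq_tsum_setLIntegral_preimage_singleton {ι : Type*} [Countable ι]
    [MeasurableSpace ι] [MeasurableSingletonClass ι] {π : X → ι} (hπ : Measurable π)
    (f : X → ℝ≥0∞) : ∫⁻ x, f x ∂μ = ∑' i, ∫⁻ x in π ⁻¹' {i}, f x ∂μ := by
  rw [← lintegral_iUnion (fun i => hπ (measurableSet_singleton i))
    (fun i j hij => Disjoint.preimage π (Set.disjoint_singleton.2 hij)),
    ← Set.preimage_iUnion, Set.iUnion_of_singleton, Set.preimage_univ, setLIntegral_univ]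

theorem setLIntegral_preimage_singleton_comp {ι : Type*} [MeasurableSpace ι]
    [MeasurableSingletonClass ι] {π : X → ι} (hπ : Measurable π) (F : ι → X → ℝ≥0∞) (i : ι) :
    ∫⁻ x in π ⁻¹' {i}, F (π x) x ∂μ = ∫⁻ x in π ⁻¹' {i}, F i x ∂μ :=
  setLIntegral_congr_fun (hπ (measurableSet_singleton i)) fun x hx => by
    rw [Set.mem_preimage.1 hx]

theorem exists_setLIntegral_preimage_Ici_le {π : X → ℕ} (hπ : Measurable π) {f : X → ℝ≥0∞}
    (hf : ∫⁻ x, f x ∂ν ≠ ∞) {η : ℝ≥0∞} (hη : 0 < η) :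
    ∃ N, ∫⁻ x in π ⁻¹' Set.Ici N, f x ∂ν ≤ η := by
  have hmeas : ∀ N, MeasurableSet (π ⁻¹' Set.Ici N) := fun N => hπ measurableSet_Ici
  have hlim : Tendsto (fun N => ν.withDensity f (π ⁻¹' Set.Ici N)) atTop (𝓝 0) := by
    have hempty : ⋂ N, π ⁻¹' Set.Ici N = ∅ :=
      Set.eq_empty_of_forall_notMem fun x hx => (π x).not_succ_le_self (Set.mem_iInter.1 hx _)
    rw [← measure_empty (μ := ν.withDensity f), ← hempty]
    have := isFiniteMeasure_withDensity hf
    exact tendsto_measure_iInter_atTop (fun N => (hmeas N).nullMeasurableSet)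
      (fun M N hMN => Set.preimage_mono (Set.Ici_subset_Ici.2 hMN)) ⟨0, measure_ne_top _ _⟩
  simpa only [withDensity_apply f (hmeas _)] using (ENNReal.tendsto_nhds_zero.1 hlim η hη).exists

theorem exists_mem_diff_le_setLAverage {s N : Set X} (hs0 : μ s ≠ 0) (hs : μ s ≠ ∞)
    (hN : μ N = 0) {f : X → ℝ≥0∞} (hf : AEMeasurable f μ) :
    ∃ x ∈ s \ N, f x ≤ ⨍⁻ y in s, f y ∂μ := by
  have hdiff : μ (s \ N) = μ s := measure_sdiff_null hN
  rw [← setLAverage_congr (sdiff_null_ae_eq_self hN)]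
  exact exists_le_setLAverage (hdiff ▸ hs0) (hdiff ▸ hs) hf.restrict

theorem lintegral_add_rpow_le_two_rpow_mul {f : X → ℝ≥0∞} (hf : Measurable f) (g : X → ℝ≥0∞)
    (ht : 0 ≤ t) :
    ∫⁻ x, (f x + g x) ^ t ∂μ ≤ 2 ^ t * (∫⁻ x, f x ^ t ∂μ + ∫⁻ x, g x ^ t ∂μ) :=
  calc ∫⁻ x, (f x + g x) ^ t ∂μ ≤ ∫⁻ x, 2 ^ t * (f x ^ t + g x ^ t) ∂μ :=
        lintegral_mono fun x => add_rpow_le_two_rpow_mul _ _ ht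
    _ = 2 ^ t * (∫⁻ x, f x ^ t ∂μ + ∫⁻ x, g x ^ t ∂μ) := by
        rw [lintegral_const_mul' _ _ (by finiteness), lintegral_add_left (hf.pow_const t)]

theorem lintegral_le_mul_lintegral_of_le_smul {C : ℝ≥0} (hν : ν ≤ C • μ) (f : X → ℝ≥0∞) :
    ∫⁻ x, f x ∂ν ≤ C * ∫⁻ x, f x ∂μ :=
  (lintegral_mono' hν le_rfl).trans (lintegral_smul_measure C f).le

variable [NormedAddCommGroup E] {d : X → X → ℝ} {r : ℝ} {π : X → ℕ}

theorem exists_setLIntegral_enorm_sub_const_rpow_le {s N : Set X} (hs : MeasurableSet s)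
    (hsμ : μ s ≠ ∞) (hN : μ N = 0) (ht : 0 < t) {u : X → E} {h : X → ℝ≥0∞} (hh : Measurable h)
    (hosc : ∀ x ∈ s \ N, ∀ y ∈ s \ N, ‖u x - u y‖ₑ ≤ h x + h y) :
    ∃ c : E, (μ s = 0 → c = 0) ∧
      ∫⁻ x in s, ‖u x - c‖ₑ ^ t ∂μ ≤ 2 ^ t * 2 * ∫⁻ x in s, h x ^ t ∂μ := by
  by_cases hs0 : μ s = 0
  · exact ⟨0, fun _ => rfl, by simp [setLIntegral_measure_zero _ _ hs0]⟩
  obtain ⟨y, hy, hle⟩ :=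
    exists_mem_diff_le_setLAverage hs0 hsμ hN (hh.pow_const t).aemeasurable
  refine ⟨u y, fun h0 => absurd h0 hs0, ?_⟩
  calc ∫⁻ x in s, ‖u x - u y‖ₑ ^ t ∂μ
      ≤ ∫⁻ x in s, 2 ^ t * (h x ^ t + ⨍⁻ z in s, h z ^ t ∂μ) ∂μ := by
        refine lintegral_mono_ae ?_
        filter_upwards [ae_restrict_mem hs, ae_restrict_of_ae (measure_eq_zero_iff_ae_notMem.1 hN)]
          with x hxs hxN
        refine (ENNReal.rpow_le_rpow (hosc x ⟨hxs, hxN⟩ y hy) ht.le).trans ?_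
        grw [add_rpow_le_two_rpow_mul _ _ ht.le, hle]
    _ = 2 ^ t * (∫⁻ x in s, h x ^ t ∂μ + μ s * ⨍⁻ z in s, h z ^ t ∂μ) := by
        rw [lintegral_const_mul' _ _ (by finiteness), lintegral_add_left (hh.pow_const t),
          setLIntegral_const, mul_comm (μ s)]
    _ = 2 ^ t * 2 * ∫⁻ x in s, h x ^ t ∂μ := by
        rw [measure_mul_setLAverage _ hsμ]
        ring

/-- Off a `μ`-null set, `u` oscillates by at most `h x + h y` at `d`-distances smaller than `r`:
the only property of fractional gradients that the compactness argument uses. -/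
def HasOscillationBound (d : X → X → ℝ) (μ : Measure X) (r : ℝ) (u : X → E) (h : X → ℝ≥0∞) :
    Prop :=
  Measurable h ∧ ∃ N : Set X, μ N = 0 ∧
    ∀ x ∉ N, ∀ y ∉ N, d x y < r → ‖u x - u y‖ₑ ≤ h x + h y

/-- The fibres of `π` form a countable measurable partition of `X` into cells of finite measure
in which all distances are smaller than `r`. -/
structure IsPartitionIndex (d : X → X → ℝ) (μ : Measure X) (r : ℝ) (π : X → ℕ) : Prop where
  measurable : Measurable π
  measure_fiber_ne_top : ∀ i, μ (π ⁻¹' {i}) ≠ ∞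
  dist_lt : ∀ x y, π x = π y → d x y < r

theorem HasOscillationBound.exists_lintegral_enorm_sub_step_rpow_le {u : X → E} {h : X → ℝ≥0∞}
    (hu : HasOscillationBound d μ r u h) (hπ : IsPartitionIndex d μ r π) (ht : 0 < t) :
    ∃ c : ℕ → E, (∀ i, μ (π ⁻¹' {i}) = 0 → c i = 0) ∧
      ∫⁻ x, ‖u x - c (π x)‖ₑ ^ t ∂μ ≤ 2 ^ t * 2 * ∫⁻ x, h x ^ t ∂μ := by
  obtain ⟨hh, N, hN, hosc⟩ := hu
  have hfiber : ∀ i, MeasurableSet (π ⁻¹' {i}) := fun i =>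
    hπ.measurable (measurableSet_singleton i)
  choose c hc0 hc using fun i => exists_setLIntegral_enorm_sub_const_rpow_le (hfiber i)
    (hπ.measure_fiber_ne_top i) hN ht hh fun x hx y hy =>
      hosc x hx.2 y hy.2 (hπ.dist_lt x y (Eq.trans hx.1 (Eq.symm hy.1)))
  refine ⟨c, hc0, ?_⟩
  calc ∫⁻ x, ‖u x - c (π x)‖ₑ ^ t ∂μ
      = ∑' i, ∫⁻ x in π ⁻¹' {i}, ‖u x - c i‖ₑ ^ t ∂μ := by
        rw [lintegral_eq_tsum_setLIntegral_preimage_singleton hπ.measurable]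
        exact tsum_congr fun i =>
          setLIntegral_preimage_singleton_comp hπ.measurable (fun i x => ‖u x - c i‖ₑ ^ t) i
    _ ≤ ∑' i, 2 ^ t * 2 * ∫⁻ x in π ⁻¹' {i}, h x ^ t ∂μ := ENNReal.tsum_le_tsum hc
    _ = 2 ^ t * 2 * ∫⁻ x, h x ^ t ∂μ := by
        rw [ENNReal.tsum_mul_left,
          ← lintegral_eq_tsum_setLIntegral_preimage_singleton hπ.measurable]

theorem enorm_step_rpow_mul_measure_fiber_le (hπ : Measurable π) (ht : 0 < t) {u : X → E}
    (hu : AEStronglyMeasurable u μ) (c : ℕ → E) (i : ℕ) :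
    ‖c i‖ₑ ^ t * μ (π ⁻¹' {i}) ≤
      2 ^ t * (∫⁻ x, ‖u x - c (π x)‖ₑ ^ t ∂μ + ∫⁻ x, ‖u x‖ₑ ^ t ∂μ) :=
  calc ‖c i‖ₑ ^ t * μ (π ⁻¹' {i}) = ∫⁻ x in π ⁻¹' {i}, ‖c (π x)‖ₑ ^ t ∂μ := by
        rw [setLIntegral_preimage_singleton_comp hπ (fun i _ => ‖c i‖ₑ ^ t), setLIntegral_const]
    _ ≤ ∫⁻ x, ‖c (π x)‖ₑ ^ t ∂μ := setLIntegral_le_lintegral _ _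
    _ ≤ 2 ^ t * (∫⁻ x, ‖u x - c (π x)‖ₑ ^ t ∂μ + ∫⁻ x, ‖u x‖ₑ ^ t ∂μ) := by
        simpa [enorm_sub_rev] using lintegral_enorm_sub_rpow_le_two_rpow_mul (h := 0) ht.le
          ((stronglyMeasurable_comp_nat hπ c).aestronglyMeasurable.sub hu)

theorem HasOscillationBound.ae_enorm_rpow_le {u : X → E} {h : X → ℝ≥0∞}
    (hosc : HasOscillationBound d μ r u h) (hd : ∀ x, μ (quasiBall d x r) ≠ 0)
    (hd' : ∀ x, μ (quasiBall d x r) ≠ ∞) (ht : 0 < t) (hu : AEStronglyMeasurable u μ) :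
    ∀ᵐ x ∂μ, ‖u x‖ₑ ^ t ≤
      2 ^ t * (h x ^ t + (∫⁻ y, (h y + ‖u y‖ₑ) ^ t ∂μ) * (μ (quasiBall d x r))⁻¹) := by
  obtain ⟨hh, N, hN, hosc⟩ := hosc
  have hmeas : AEMeasurable (fun y => (h y + ‖u y‖ₑ) ^ t) μ :=
    (hh.aemeasurable.add hu.enorm).pow_const t
  filter_upwards [measure_eq_zero_iff_ae_notMem.1 hN] with x hx
  obtain ⟨y, ⟨hxy, hy⟩, hle⟩ := exists_mem_diff_le_setLAverage (hd x) (hd' x) hN hmeas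
  rw [setLAverage_eq, div_eq_mul_inv] at hle
  have huxy : ‖u x‖ₑ ≤ h x + (h y + ‖u y‖ₑ) :=
    calc ‖u x‖ₑ ≤ ‖u x - u y‖ₑ + ‖u y‖ₑ := by simpa using enorm_add_le (u x - u y) (u y)
      _ ≤ h x + (h y + ‖u y‖ₑ) := by grw [hosc x hx y hy hxy, add_assoc]
  grw [huxy, add_rpow_le_two_rpow_mul _ _ ht.le, hle, setLIntegral_le_lintegral]

theorem HasOscillationBound.setLIntegral_enorm_rpow_le {u : X → E} {h : X → ℝ≥0∞}
    (hosc : HasOscillationBound d μ r u h) (hd : ∀ x, μ (quasiBall d x r) ≠ 0)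
    (hd' : ∀ x, μ (quasiBall d x r) ≠ ∞) (hνμ : ν ≪ μ) (ht : 0 < t)
    (hu : AEStronglyMeasurable u μ) (hfin : ∫⁻ x, (h x + ‖u x‖ₑ) ^ t ∂μ ≠ ∞) (R : Set X) :
    ∫⁻ x in R, ‖u x‖ₑ ^ t ∂ν ≤ 2 ^ t * (∫⁻ x, h x ^ t ∂ν +
      (∫⁻ x, (h x + ‖u x‖ₑ) ^ t ∂μ) * ∫⁻ x in R, (μ (quasiBall d x r))⁻¹ ∂ν) :=
  calc ∫⁻ x in R, ‖u x‖ₑ ^ t ∂ν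
      ≤ ∫⁻ x in R, 2 ^ t * (h x ^ t +
          (∫⁻ y, (h y + ‖u y‖ₑ) ^ t ∂μ) * (μ (quasiBall d x r))⁻¹) ∂ν :=
        lintegral_mono_ae (ae_restrict_of_ae (hνμ.ae_le (hosc.ae_enorm_rpow_le hd hd' ht hu)))
    _ = 2 ^ t * (∫⁻ x in R, h x ^ t ∂ν +
          (∫⁻ x, (h x + ‖u x‖ₑ) ^ t ∂μ) * ∫⁻ x in R, (μ (quasiBall d x r))⁻¹ ∂ν) := by
        rw [lintegral_const_mul' _ _ (by finiteness), lintegral_add_left (hosc.1.pow_const t),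
          lintegral_const_mul' _ _ hfin]
    _ ≤ _ := by grw [setLIntegral_le_lintegral]

theorem lintegral_enorm_sub_ite_rpow_le (hπ : Measurable π) (N : ℕ) (u : X → E) (c : ℕ → E) :
    ∫⁻ x, ‖u x - if π x < N then c (π x) else 0‖ₑ ^ t ∂ν ≤
      ∫⁻ x, ‖u x - c (π x)‖ₑ ^ t ∂ν + ∫⁻ x in π ⁻¹' Set.Ici N, ‖u x‖ₑ ^ t ∂ν := by
  have hN : MeasurableSet (π ⁻¹' Set.Ici N) := hπ measurableSet_Ici
  rw [← lintegral_add_compl _ hN, add_comm]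
  refine add_le_add (le_trans (le_of_eq ?_) (setLIntegral_le_lintegral (π ⁻¹' Set.Ici N)ᶜ _))
    (le_of_eq ?_)
  · exact setLIntegral_congr_fun hN.compl fun x (hx : ¬N ≤ π x) => by
      rw [if_pos (not_le.1 hx)]
  · exact setLIntegral_congr_fun hN fun x hx => by rw [if_neg (not_lt.2 hx), sub_zero]

theorem lintegral_step_rpow_ne_top (hπ : Measurable π) (hfin : ∀ i, ν (π ⁻¹' {i}) ≠ ∞)
    (ht : 0 < t) {b : ℕ → ℝ≥0} {N : ℕ} (hb : ∀ i, N ≤ i → b i = 0) :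
    ∫⁻ x, (b (π x) : ℝ≥0∞) ^ t ∂ν ≠ ∞ := by
  have hfiber : ∀ i, ∫⁻ x in π ⁻¹' {i}, (b (π x) : ℝ≥0∞) ^ t ∂ν =
      (b i : ℝ≥0∞) ^ t * ν (π ⁻¹' {i}) := fun i => by
    rw [setLIntegral_preimage_singleton_comp hπ (fun i _ => (b i : ℝ≥0∞) ^ t), setLIntegral_const]
  rw [lintegral_eq_tsum_setLIntegral_preimage_singleton hπ, tsum_congr hfiber,
    tsum_eq_sum (s := Finset.range N) fun i hi => by
      simp [hb i (not_lt.1 (Finset.mem_range.not.1 hi)), ENNReal.zero_rpow_of_pos ht]]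
  exact ENNReal.sum_ne_top.2 fun i _ => ENNReal.mul_ne_top (by finiteness) (hfin i)

theorem exists_enorm_le_of_enorm_rpow_mul_le (ht : 0 < t) {L : ℝ≥0∞} (hL : L ≠ ∞) (m : ℝ≥0∞) :
    ∃ b : ℝ≥0, ∀ c : E, (m = 0 → c = 0) → ‖c‖ₑ ^ t * m ≤ L → ‖c‖ₑ ≤ b := by
  by_cases hm : m = 0
  · exact ⟨0, fun c hc _ => by simp [hc hm]⟩
  have hfin : (L / m) ^ t⁻¹ ≠ ∞ :=
    ENNReal.rpow_ne_top_of_nonneg (inv_nonneg.2 ht.le) (ENNReal.div_ne_top hL hm)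
  refine ⟨((L / m) ^ t⁻¹).toNNReal, fun c _ hc => ?_⟩
  rw [ENNReal.coe_toNNReal hfin, ENNReal.le_rpow_inv_iff ht]
  exact (ENNReal.le_div_iff_mul_le (Or.inl hm) (Or.inr hL)).2 hc

theorem hasDominatedStepApprox_of_hasOscillationBound {ι : Type*} {u : ι → X → E}
    (hπ : IsPartitionIndex d μ r π) (hd : ∀ x, μ (quasiBall d x r) ≠ 0)
    (hd' : ∀ x, μ (quasiBall d x r) ≠ ∞) {C : ℝ≥0} (hν : ν ≤ C • μ)
    (hI : ∫⁻ x, (μ (quasiBall d x r))⁻¹ ∂ν ≠ ∞) (ht : 0 < t)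
    (hu : ∀ n, AEStronglyMeasurable (u n) μ) {M ε : ℝ≥0∞} (hM : M ≠ ∞) (hε0 : 0 < ε)
    (hε : ε ≠ ∞) (huM : ∀ n, ∫⁻ x, ‖u n x‖ₑ ^ t ∂μ ≤ M)
    (hosc : ∀ n, ∃ h, HasOscillationBound d μ r (u n) h ∧ ∫⁻ x, h x ^ t ∂μ ≤ ε) :
    HasDominatedStepApprox ν t u ((2 ^ t * 3 * C + 1) * ε) := by
  choose h hh hhε using hosc
  choose c hc0 hc using fun n => (hh n).exists_lintegral_enorm_sub_step_rpow_le hπ ht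
  choose b hb using fun i => exists_enorm_le_of_enorm_rpow_mul_le (E := E) ht
    (by finiteness : 2 ^ t * (2 ^ t * 2 * ε + M) ≠ ∞) (μ (π ⁻¹' {i}))
  have hF : ∀ n, ∫⁻ x, (h n x + ‖u n x‖ₑ) ^ t ∂μ ≤ 2 ^ t * (ε + M) := fun n => by
    grw [lintegral_add_rpow_le_two_rpow_mul (hh n).1 _ ht.le, hhε n, huM n]
  obtain ⟨N, hN⟩ := exists_setLIntegral_preimage_Ici_le hπ.measurable hI
    (ENNReal.div_pos hε0.ne' (by finiteness : 2 ^ t * (2 ^ t * (ε + M)) ≠ ∞))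
  refine ⟨π, hπ.measurable, fun i => if i < N then b i else 0, ?_,
    fun n => ⟨fun i => if i < N then c n i else 0, fun i => ?_, ?_⟩⟩
  · refine lintegral_step_rpow_ne_top (N := N) hπ.measurable (fun i => ?_) ht fun i hi =>
      if_neg hi.not_gt
    exact ne_top_of_le_ne_top
      (ENNReal.mul_ne_top ENNReal.coe_ne_top (hπ.measure_fiber_ne_top i)) (hν _)
  · by_cases hi : i < N
    · simp only [hi, if_true]
      refine hb i _ (hc0 n i) ?_
      grw [enorm_step_rpow_mul_measure_fiber_le hπ.measurable ht (hu n), hc n, hhε n, huM n]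
    · simp [hi]
  · calc ∫⁻ x, ‖u n x - if π x < N then c n (π x) else 0‖ₑ ^ t ∂ν
        ≤ ∫⁻ x, ‖u n x - c n (π x)‖ₑ ^ t ∂ν + ∫⁻ x in π ⁻¹' Set.Ici N, ‖u n x‖ₑ ^ t ∂ν :=
          lintegral_enorm_sub_ite_rpow_le hπ.measurable N (u n) (c n)
      _ ≤ C * (2 ^ t * 2 * ε) + 2 ^ t * (C * ε + 2 ^ t * (ε + M) *
            (ε / (2 ^ t * (2 ^ t * (ε + M))))) := by
          grw [(hh n).setLIntegral_enorm_rpow_le hd hd' (Measure.absolutelyContinuous_of_le_smul hν)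
            ht (hu n) (ne_top_of_le_ne_top (by finiteness) (hF n)), hF n, hN,
            lintegral_le_mul_lintegral_of_le_smul hν, lintegral_le_mul_lintegral_of_le_smul hν,
            hc n, hhε n]
      _ = 2 ^ t * 3 * C * ε +
            2 ^ t * (2 ^ t * (ε + M)) * (ε / (2 ^ t * (2 ^ t * (ε + M)))) := by ring
      _ ≤ (2 ^ t * 3 * C + 1) * ε := by grw [ENNReal.mul_div_le, add_mul, one_mul]

end Oscillation

section Geometry

variable {X : Type*} {d : X → X → ℝ} {r : ℝ}

theorem IsQuasiMetric.self_mem_quasiBall (hd : IsQuasiMetric d) (x : X) (hr : 0 < r) :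
    x ∈ quasiBall d x r :=
  ((hd.eq_zero_iff x x).2 rfl).trans_lt hr

theorem IsQuasiMetric.exists_pos_forall_lt_of_lt (hd : IsQuasiMetric d) (hr : 0 < r) :
    ∃ ρ, 0 < ρ ∧ ∀ {x y z}, d x z < ρ ∨ d z x < ρ → d z y < ρ ∨ d y z < ρ → d x y < r := by
  obtain ⟨C₀, hC₀, hsymm⟩ := hd.quasi_symm
  obtain ⟨C₁, hC₁, htri⟩ := hd.quasi_triangle
  have swap : ∀ {x y}, d x y < r / C₁ / C₀ → d y x < r / C₁ := fun {x y} h =>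
    (hsymm x y).trans_lt ((lt_div_iff₀' hC₀).1 h)
  refine ⟨min (r / C₁) (r / C₁ / C₀), by positivity, fun {x y z} hx hy => ?_⟩
  have hxz : d x z < r / C₁ :=
    hx.elim (fun h => h.trans_le (min_le_left _ _)) fun h => swap (h.trans_le (min_le_right _ _))
  have hzy : d z y < r / C₁ :=
    hy.elim (fun h => h.trans_le (min_le_left _ _)) fun h => swap (h.trans_le (min_le_right _ _))
  exact (htri x y z).trans_lt ((lt_div_iff₀' hC₁).1 (max_lt hxz hzy))

variable [MeasurableSpace X] {μ ν : Measure X}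

theorem IsQuasiMetricMeasureSpace.sigmaFinite (hX : IsQuasiMetricMeasureSpace d μ) :
    SigmaFinite μ := by
  obtain hempty | ⟨⟨x₀⟩⟩ := isEmpty_or_nonempty X
  · rw [μ.eq_zero_of_isEmpty]
    infer_instance
  refine ⟨⟨⟨fun n => quasiBall d x₀ (n + 1), fun _ => trivial,
    fun n => hX.ball_lt_top _ _ n.cast_add_one_pos, Set.eq_univ_of_forall fun x => ?_⟩⟩⟩
  obtain ⟨n, hn⟩ := exists_nat_gt (d x₀ x)
  exact Set.mem_iUnion.2 ⟨n, hn.trans (lt_add_one _)⟩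

theorem IsQuasiMetricMeasureSpace.exists_countable_net (hX : IsQuasiMetricMeasureSpace d μ)
    (hr : 0 < r) : ∃ s : Set X, s.Countable ∧ ∀ x, ∃ y ∈ s, d y x < r := by
  have := hX.sigmaFinite
  obtain ⟨ρ, hρ, hρr⟩ := hX.isQuasiMetric.exists_pos_forall_lt_of_lt hr
  obtain ⟨s, -, hdisj, hmeet⟩ := Vitali.exists_disjoint_subfamily_covering_enlargement
    (fun x => quasiBall d x ρ) Set.univ (fun _ => 1) 2 one_lt_two (by simp) 1 (by simp)
    fun x _ => ⟨x, hX.isQuasiMetric.self_mem_quasiBall x hρ⟩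
  refine ⟨s, ?_, fun x => ?_⟩
  · have hpos := Measure.countable_meas_pos_of_disjoint_iUnion (μ := μ)
      (As := fun y : s => quasiBall d y ρ) (fun y => hX.measurableSet_ball y ρ hρ)
      fun y z hyz => hdisj y.2 z.2 (Subtype.coe_ne_coe.2 hyz)
    exact Set.countable_coe_iff.1 (Set.countable_univ_iff.1 (hpos.mono fun y _ =>
      hX.ball_pos y ρ hρ))
  · obtain ⟨y, hy, ⟨z, hxz, hyz⟩, -⟩ := hmeet x trivial
    exact ⟨y, hy, hρr (.inl hyz) (.inr hxz)⟩

theorem IsQuasiMetricMeasureSpace.exists_isPartitionIndex (hX : IsQuasiMetricMeasureSpace d μ)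
    (hr : 0 < r) : ∃ π, IsPartitionIndex d μ r π := by
  classical
  obtain hempty | ⟨⟨x₀⟩⟩ := isEmpty_or_nonempty X
  · exact ⟨isEmptyElim, measurable_of_empty _, fun i => by simp [μ.eq_zero_of_isEmpty],
      isEmptyElim⟩
  obtain ⟨ρ, hρ, hρr⟩ := hX.isQuasiMetric.exists_pos_forall_lt_of_lt hr
  obtain ⟨s, hs, hnet⟩ := hX.exists_countable_net hρ
  obtain ⟨e, rfl⟩ := hs.exists_eq_range ((hnet x₀).imp fun _ hy => hy.1)
  have hcover : ∀ x, ∃ i, d (e i) x < ρ := fun x => Set.exists_range_iff.1 (hnet x)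
  have hdist : ∀ x, d (e (Nat.find (hcover x))) x < ρ := fun x => Nat.find_spec (hcover x)
  refine ⟨fun x => Nat.find (hcover x), measurable_find _ fun i => hX.measurableSet_ball _ ρ hρ,
    fun i => ?_, fun x y hxy => hρr (.inr (hdist x)) (.inl (hxy ▸ hdist y))⟩
  refine measure_ne_top_of_subset ?_ (hX.ball_lt_top (e i) ρ hρ).ne
  rintro x rfl
  exact hdist x

theorem IsIntegrableMeasure.lintegral_inv_measure_quasiBall_lt_top
    (hI : IsIntegrableMeasure d μ ν) (hr : 0 < r) :
    ∫⁻ x, (μ (quasiBall d x r))⁻¹ ∂ν < ∞ := by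
  obtain ⟨ρ, -, ⟨κ, hκ, hdρ⟩, -, hρ⟩ := hI
  refine (lintegral_mono fun x => ENNReal.inv_le_inv.2 (measure_mono fun y hy => ?_)).trans_lt
    (hρ (r / κ) (div_pos hr hκ)).2
  exact (hdρ x y).2.trans_lt ((lt_div_iff₀' hκ).1 hy)

theorem QuasiTotallyBounded.lintegral_inv_measure_quasiBall_lt_top (hd : QuasiTotallyBounded d)
    (hX : IsQuasiMetricMeasureSpace d μ) {C : ℝ≥0} (hν : ν ≤ C • μ) (hr : 0 < r) :
    ∫⁻ x, (μ (quasiBall d x r))⁻¹ ∂ν < ∞ := by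
  obtain ⟨ρ, hρ, hρr⟩ := hX.isQuasiMetric.exists_pos_forall_lt_of_lt hr
  obtain ⟨s, hs, hcover⟩ := hd ρ hρ
  have hball : ∀ y, ∫⁻ x in quasiBall d y ρ, (μ (quasiBall d x r))⁻¹ ∂ν ≤ C := fun y =>
    calc ∫⁻ x in quasiBall d y ρ, (μ (quasiBall d x r))⁻¹ ∂ν
        ≤ ∫⁻ _ in quasiBall d y ρ, (μ (quasiBall d y ρ))⁻¹ ∂ν :=
          setLIntegral_mono' (hX.measurableSet_ball y ρ hρ) fun x hx =>
            ENNReal.inv_le_inv.2 (measure_mono fun z hz => hρr (.inr hx) (.inl hz))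
      _ = (μ (quasiBall d y ρ))⁻¹ * ν (quasiBall d y ρ) := setLIntegral_const _ _
      _ ≤ (μ (quasiBall d y ρ))⁻¹ * (C * μ (quasiBall d y ρ)) := by gcongr; exact hν _
      _ = C := by
          rw [mul_left_comm, ENNReal.inv_mul_cancel (hX.ball_pos y ρ hρ).ne'
            (hX.ball_lt_top y ρ hρ).ne, mul_one]
  have hunion : ⋃ y : s, quasiBall d y ρ = Set.univ :=
    Set.eq_univ_of_forall fun x => by simpa using hcover x
  have := hs.to_subtype
  calc ∫⁻ x, (μ (quasiBall d x r))⁻¹ ∂ν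
      = ∫⁻ x in ⋃ y : s, quasiBall d y ρ, (μ (quasiBall d x r))⁻¹ ∂ν := by
        rw [hunion, setLIntegral_univ]
    _ ≤ ∑' y : s, ∫⁻ x in quasiBall d y ρ, (μ (quasiBall d x r))⁻¹ ∂ν := lintegral_iUnion_le _ _
    _ ≤ ∑' _ : s, (C : ℝ≥0∞) := ENNReal.tsum_le_tsum fun y => hball y
    _ < ∞ := by
        rw [ENNReal.tsum_const]
        exact ENNReal.mul_lt_top (by simp [Set.toFinite]) ENNReal.coe_lt_top

end Geometry

section Embedding

variable {X : Type*} [MeasurableSpace X] {d : X → X → ℝ} {μ ν : Measure X} {C : ℝ≥0}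

theorem HasDominatedStepApprox.mono {E ι : Type*} [NormedAddCommGroup E] {t : ℝ}
    {u : ι → X → E} {ε ε' : ℝ≥0∞} (hu : HasDominatedStepApprox ν t u ε) (hε : ε ≤ ε') :
    HasDominatedStepApprox ν t u ε' := by
  obtain ⟨π, hπ, b, hb, hc⟩ := hu
  exact ⟨π, hπ, b, hb, fun n => (hc n).imp fun c hc => ⟨hc.1, hc.2.trans hε⟩⟩

theorem IsQuasiMetricMeasureSpace.exists_subseq_tendsto_of_hasOscillationBound {E : Type*}
    [NormedAddCommGroup E] [ProperSpace E] (hX : IsQuasiMetricMeasureSpace d μ) (hν : ν ≤ C • μ)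
    (hI : ∀ r, 0 < r → ∫⁻ x, (μ (quasiBall d x r))⁻¹ ∂ν < ∞) {t : ℝ} (ht : 0 < t)
    {u : ℕ → X → E} (hu : ∀ n, AEStronglyMeasurable (u n) μ) {M : ℝ≥0∞} (hM : M ≠ ∞)
    (huM : ∀ n, ∫⁻ x, ‖u n x‖ₑ ^ t ∂μ ≤ M)
    (hosc : ∀ ε : ℝ≥0∞, 0 < ε → ∃ r : ℝ, 0 < r ∧
      ∀ n, ∃ h, HasOscillationBound d μ r (u n) h ∧ ∫⁻ x, h x ^ t ∂μ ≤ ε) :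
    ∃ φ : ℕ → ℕ, StrictMono φ ∧ ∃ f : X → E, StronglyMeasurable f ∧
      Tendsto (fun n => ∫⁻ x, ‖u (φ n) x - f x‖ₑ ^ t ∂ν) atTop (𝓝 0) := by
  refine exists_subseq_tendsto_of_hasDominatedStepApprox ht
    (fun n => (hu n).mono_ac (Measure.absolutelyContinuous_of_le_smul hν)) fun ε hε => ?_
  have hε' : 0 < min 1 (ε / (2 ^ t * 3 * C + 1)) :=
    lt_min one_pos (ENNReal.div_pos hε.ne' (by finiteness))
  obtain ⟨r, hr, hosc⟩ := hosc _ hε'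
  obtain ⟨π, hπ⟩ := hX.exists_isPartitionIndex hr
  refine (hasDominatedStepApprox_of_hasOscillationBound hπ (fun x => (hX.ball_pos x r hr).ne')
    (fun x => (hX.ball_lt_top x r hr).ne) hν (hI r hr).ne ht hu hM hε'
    (ne_top_of_le_ne_top ENNReal.one_ne_top (min_le_left _ _)) huM hosc).mono ?_
  grw [min_le_right, ENNReal.mul_div_le]

theorem eLpNorm_le_iff_lintegral_rpow_enorm_le {ε : Type*} [ENorm ε] {f : X → ε} {p M : ℝ≥0∞}
    (hp0 : p ≠ 0) (hp : p ≠ ∞) :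
    eLpNorm f p μ ≤ M ↔ ∫⁻ x, ‖f x‖ₑ ^ p.toReal ∂μ ≤ M ^ p.toReal := by
  rw [eLpNorm_eq_lintegral_rpow_enorm_toReal hp0 hp, one_div,
    ENNReal.rpow_inv_le_iff (ENNReal.toReal_pos hp0 hp)]

theorem tendsto_eLpNorm_of_tendsto_lintegral_rpow_enorm {ι ε : Type*} [ENorm ε] {l : Filter ι}
    {f : ι → X → ε} {p : ℝ≥0∞} (hp0 : p ≠ 0) (hp : p ≠ ∞)
    (hf : Tendsto (fun i => ∫⁻ x, ‖f i x‖ₑ ^ p.toReal ∂μ) l (𝓝 0)) :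
    Tendsto (fun i => eLpNorm (f i) p μ) l (𝓝 0) := by
  simp only [eLpNorm_eq_lintegral_rpow_enorm_toReal hp0 hp]
  simpa [ENNReal.zero_rpow_of_pos, ENNReal.toReal_pos hp0 hp] using hf.ennrpow_const (1 / p.toReal)

theorem memLp_of_tendsto_eLpNorm_sub {E : Type*} [NormedAddCommGroup E] {u : ℕ → X → E}
    {f : X → E} {p : ℝ≥0∞} (hu : ∀ n, MemLp (u n) p ν) (hf : AEStronglyMeasurable f ν)
    (hlim : Tendsto (fun n => eLpNorm (u n - f) p ν) atTop (𝓝 0)) : MemLp f p ν := by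
  obtain ⟨n, hn⟩ := (hlim.eventually_lt_const ENNReal.zero_lt_top).exists
  have hdiff : MemLp (u n - f) p ν := ⟨(hu n).aestronglyMeasurable.sub hf, hn⟩
  simpa using (hu n).sub hdiff

theorem isCompactlyEmbeddedInLp_of_hasOscillationBound (hX : IsQuasiMetricMeasureSpace d μ)
    (hν : ν ≤ C • μ) (hI : ∀ r, 0 < r → ∫⁻ x, (μ (quasiBall d x r))⁻¹ ∂ν < ∞) {p : ℝ≥0∞}
    (hp0 : p ≠ 0) (hp : p ≠ ∞) {H : (X → ℝ) → ℝ≥0∞}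
    (hH : ∀ M : ℝ≥0, ∀ ε : ℝ≥0∞, 0 < ε → ∃ r : ℝ, 0 < r ∧ ∀ u, H u ≤ M →
      ∃ h, HasOscillationBound d μ r u h ∧ ∫⁻ x, h x ^ p.toReal ∂μ ≤ ε) :
    IsCompactlyEmbeddedInLp (inhomSpace μ p H) (inhomNorm μ p H) p ν := by
  have ht : 0 < p.toReal := ENNReal.toReal_pos hp0 hp
  have hmem : ∀ u ∈ inhomSpace μ p H, MemLp u p ν := fun u hu =>
    hu.2.1.of_measure_le_smul ENNReal.coe_ne_top hν
  refine ⟨hmem, ⟨C ^ p.toReal⁻¹, fun u _ => ?_⟩, fun u hu ⟨M, hM⟩ => ?_⟩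
  · calc eLpNorm u p ν ≤ eLpNorm u p (C • μ) := eLpNorm_mono_measure u hν
      _ = C ^ p.toReal⁻¹ • eLpNorm u p μ := eLpNorm_smul_measure_of_ne_top' hp C u
      _ ≤ C ^ p.toReal⁻¹ • inhomNorm μ p H u := by gcongr; exact le_self_add
  · obtain ⟨φ, hφ, f, hf, hlim⟩ := hX.exists_subseq_tendsto_of_hasOscillationBound hν hI ht
      (fun n => (hu n).2.1.aestronglyMeasurable)
      (ENNReal.rpow_ne_top_of_nonneg ht.le (ENNReal.coe_ne_top (r := M)))
      (fun n => (eLpNorm_le_iff_lintegral_rpow_enorm_le hp0 hp).1 (le_self_add.trans (hM n)))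
      fun ε hε => (hH M ε hε).imp fun r h => ⟨h.1, fun n => h.2 _ (le_add_self.trans (hM n))⟩
    have hlim' : Tendsto (fun n => eLpNorm (u (φ n) - f) p ν) atTop (𝓝 0) :=
      tendsto_eLpNorm_of_tendsto_lintegral_rpow_enorm hp0 hp hlim
    exact ⟨f, memLp_of_tendsto_eLpNorm_sub (fun n => hmem _ (hu (φ n))) hf.aestronglyMeasurable
      hlim', φ, hφ, hlim'⟩

theorem IsCompactlyEmbeddedInLp.mono {S S' : Set (X → ℝ)} {N N' : (X → ℝ) → ℝ≥0∞} {p : ℝ≥0∞}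
    (h : IsCompactlyEmbeddedInLp S N p ν) (hS : S' ⊆ S) (hN : ∀ u, N u ≤ N' u) :
    IsCompactlyEmbeddedInLp S' N' p ν := by
  obtain ⟨hmem, ⟨K, hK⟩, hcompact⟩ := h
  refine ⟨fun u hu => hmem u (hS hu), ⟨K, fun u hu => ?_⟩,
    fun u hu ⟨M, hM⟩ => hcompact u (fun n => hS (hu n)) ⟨M, fun n => (hN _).trans (hM n)⟩⟩
  grw [hK u (hS hu), hN u]

theorem IsCompactlyEmbeddedInLp.inhom_mono {H H' : (X → ℝ) → ℝ≥0∞} {p : ℝ≥0∞}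
    (h : IsCompactlyEmbeddedInLp (inhomSpace μ p H) (inhomNorm μ p H) p ν)
    (hH : ∀ u, H u ≤ H' u) :
    IsCompactlyEmbeddedInLp (inhomSpace μ p H') (inhomNorm μ p H') p ν :=
  h.mono (fun u hu => ⟨hu.1, hu.2.1, (hH u).trans_lt hu.2.2⟩) fun u => add_le_add_right (hH u) _

end Embedding

section FractionalGradient

variable {X : Type*} [MeasurableSpace X] {d : X → X → ℝ} {μ : Measure X} {α : ℝ} {u : X → ℝ}

theorem lqNorm_top (a : ℤ → ℝ≥0∞) : lqNorm ∞ a = ⨆ k, a k :=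
  if_pos rfl

theorem lqNorm_top_le_lqNorm {q : ℝ≥0∞} (hq : 0 < q) (a : ℤ → ℝ≥0∞) :
    lqNorm ∞ a ≤ lqNorm q a := by
  rw [lqNorm_top]
  refine iSup_le fun k => ?_
  rw [lqNorm]
  split_ifs with hq'
  · exact le_iSup a k
  · rw [one_div, ENNReal.le_rpow_inv_iff (ENNReal.toReal_pos hq.ne' hq')]
    exact ENNReal.le_tsum k

theorem homBesovNorm_top_le_homBesovNorm {p q : ℝ≥0∞} (hq : 0 < q) (u : X → ℝ) :
    homBesovNorm d μ α p ∞ u ≤ homBesovNorm d μ α p q u :=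
  iInf₂_mono fun _ _ => lqNorm_top_le_lqNorm hq _

theorem homBesovNorm_top_le_homTriebelLizorkinNorm {p q : ℝ≥0∞} (hq : 0 < q) (u : X → ℝ) :
    homBesovNorm d μ α p ∞ u ≤ homTriebelLizorkinNorm d μ α p q u := by
  refine iInf₂_mono fun g _ => ?_
  rw [lqNorm_top]
  refine iSup_le fun k => eLpNorm_mono_enorm fun x => ?_
  calc g k x ≤ ⨆ k, g k x := le_iSup (fun k => g k x) k
    _ ≤ lqNorm q fun k => g k x := by grw [← lqNorm_top_le_lqNorm hq, lqNorm_top]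

theorem IsHajlaszGradient.isFractionalGradient_const {g : X → ℝ≥0∞}
    (hg : IsHajlaszGradient d μ α u g) : IsFractionalGradient d μ α u fun _ => g := by
  obtain ⟨hg, E, hE, hE0, hgE⟩ := hg
  exact ⟨fun _ => hg, E, hE, hE0, fun _ x hx y hy _ _ => hgE x hx y hy⟩

theorem homBesovNorm_top_le_homHajlaszSobolevNorm {p : ℝ≥0∞} (u : X → ℝ) :
    homBesovNorm d μ α p ∞ u ≤ homHajlaszSobolevNorm d μ α p u :=
  le_iInf₂ fun g hg => (iInf₂_le _ hg.isFractionalGradient_const).trans (by simp [lqNorm_top])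

theorem exists_nat_two_zpow_le_and_lt {s : ℝ} (hs : 0 < s) {n : ℕ}
    (hsn : s < (2 : ℝ) ^ (-(n : ℤ))) :
    ∃ j : ℕ, (2 : ℝ) ^ (-((n + j : ℕ) : ℤ) - 1) ≤ s ∧ s < (2 : ℝ) ^ (-((n + j : ℕ) : ℤ)) := by
  obtain ⟨m, hm, hm'⟩ := exists_mem_Ico_zpow hs one_lt_two
  have hmn : m < -(n : ℤ) := (zpow_lt_zpow_iff_right₀ one_lt_two).1 (hm.trans_lt hsn)
  obtain ⟨j, hj⟩ : ∃ j : ℕ, m + 1 = -((n + j : ℕ) : ℤ) := ⟨(-m - 1 - n).toNat, by omega⟩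
  exact ⟨j, by rwa [← hj, add_sub_cancel_right], by rwa [← hj]⟩

theorem ofReal_rpow_le_pow_of_lt_two_zpow (hα : 0 ≤ α) {s : ℝ} (hs : 0 ≤ s) {k : ℕ}
    (hsk : s < (2 : ℝ) ^ (-(k : ℤ))) :
    ENNReal.ofReal (s ^ α) ≤ ENNReal.ofReal ((2 : ℝ) ^ (-α)) ^ k := by
  rw [← ENNReal.ofReal_pow (by positivity)]
  refine ENNReal.ofReal_le_ofReal ?_
  calc s ^ α ≤ ((2 : ℝ) ^ (-(k : ℤ))) ^ α := Real.rpow_le_rpow hs hsk.le hα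
    _ = ((2 : ℝ) ^ (-α)) ^ k := by
        rw [← Real.rpow_intCast, ← Real.rpow_natCast, ← Real.rpow_mul zero_le_two,
          ← Real.rpow_mul zero_le_two]
        congr 1
        push_cast
        ring

theorem IsFractionalGradient.hasOscillationBound (hd : IsQuasiMetric d) (hα : 0 ≤ α)
    {g : ℤ → X → ℝ≥0∞} (hg : IsFractionalGradient d μ α u g) (n : ℕ) :
    HasOscillationBound d μ ((2 : ℝ) ^ (-(n : ℤ))) u fun x =>
      ⨆ j : ℕ, ENNReal.ofReal ((2 : ℝ) ^ (-α)) ^ (n + j) * g (n + j : ℕ) x := by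
  obtain ⟨hgm, E, -, hE, hgE⟩ := hg
  refine ⟨.iSup fun j => (hgm _).const_mul _, E, hE, fun x hx y hy hxy => ?_⟩
  obtain rfl | hne := eq_or_ne x y
  · simp
  have hpos : 0 < d x y := (hd.nonneg x y).lt_of_ne' (mt (hd.eq_zero_iff x y).1 hne)
  obtain ⟨j, hj, hj'⟩ := exists_nat_two_zpow_le_and_lt hpos hxy
  calc ‖u x - u y‖ₑ = ENNReal.ofReal |u x - u y| := Real.enorm_eq_ofReal_abs _
    _ ≤ ENNReal.ofReal (d x y ^ α) * (g (n + j : ℕ) x + g (n + j : ℕ) y) := hgE _ x hx y hy hj hj'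
    _ ≤ ENNReal.ofReal ((2 : ℝ) ^ (-α)) ^ (n + j) * (g (n + j : ℕ) x + g (n + j : ℕ) y) := by
        gcongr
        exact ofReal_rpow_le_pow_of_lt_two_zpow hα hpos.le hj'
    _ ≤ _ := by
        rw [mul_add]
        exact add_le_add (le_iSup_of_le j le_rfl) (le_iSup_of_le j le_rfl)

theorem lintegral_iSup_rpow_le_tsum {ι : Type*} [Countable ι] {a : ι → X → ℝ≥0∞}
    (ha : ∀ i, Measurable (a i)) {t : ℝ} (ht : 0 < t) :
    ∫⁻ x, (⨆ i, a i x) ^ t ∂μ ≤ ∑' i, ∫⁻ x, a i x ^ t ∂μ := by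
  rw [← lintegral_tsum fun i => ((ha i).pow_const t).aemeasurable]
  refine lintegral_mono fun x => (ENNReal.rpow_le_rpow (iSup_le fun i => ?_) ht.le).trans_eq
    (ENNReal.rpow_inv_rpow ht.ne' _)
  exact (ENNReal.le_rpow_inv_iff ht).2 (ENNReal.le_tsum i)

theorem lintegral_iSup_pow_mul_rpow_le {w L : ℝ≥0∞} {t : ℝ} (ht : 0 < t) {g : ℕ → X → ℝ≥0∞}
    (hg : ∀ j, Measurable (g j)) (hgL : ∀ j, ∫⁻ x, g j x ^ t ∂μ ≤ L) (n : ℕ) :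
    ∫⁻ x, (⨆ j, w ^ (n + j) * g j x) ^ t ∂μ ≤ (w ^ t) ^ n * ((1 - w ^ t)⁻¹ * L) :=
  calc ∫⁻ x, (⨆ j, w ^ (n + j) * g j x) ^ t ∂μ
      ≤ ∑' j, ∫⁻ x, (w ^ (n + j) * g j x) ^ t ∂μ :=
        lintegral_iSup_rpow_le_tsum (fun j => (hg j).const_mul _) ht
    _ = ∑' j, (w ^ t) ^ n * (w ^ t) ^ j * ∫⁻ x, g j x ^ t ∂μ := tsum_congr fun j => by
        simp only [ENNReal.mul_rpow_of_nonneg _ _ ht.le]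
        rw [lintegral_const_mul _ ((hg j).pow_const t), ← pow_add, ← ENNReal.rpow_natCast,
          ← ENNReal.rpow_natCast, ← ENNReal.rpow_mul, ← ENNReal.rpow_mul, mul_comm t]
    _ ≤ ∑' j, (w ^ t) ^ n * (w ^ t) ^ j * L := by gcongr with j; exact hgL j
    _ = (w ^ t) ^ n * ((1 - w ^ t)⁻¹ * L) := by
        rw [ENNReal.tsum_mul_right, ENNReal.tsum_mul_left, ENNReal.tsum_geometric, mul_assoc]

theorem exists_hasOscillationBound_of_homBesovNorm_top_le (hd : IsQuasiMetric d) (hα : 0 < α)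
    {p : ℝ≥0∞} (hp0 : p ≠ 0) (hp : p ≠ ∞) (M : ℝ≥0) {ε : ℝ≥0∞} (hε : 0 < ε) :
    ∃ r : ℝ, 0 < r ∧ ∀ u, homBesovNorm d μ α p ∞ u ≤ M →
      ∃ h, HasOscillationBound d μ r u h ∧ ∫⁻ x, h x ^ p.toReal ∂μ ≤ ε := by
  have ht : 0 < p.toReal := ENNReal.toReal_pos hp0 hp
  set w : ℝ≥0∞ := ENNReal.ofReal ((2 : ℝ) ^ (-α))
  have hw : w ^ p.toReal < 1 := ENNReal.rpow_lt_one (ENNReal.ofReal_lt_one.2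
    (Real.rpow_lt_one_of_one_lt_of_neg one_lt_two (neg_lt_zero.2 hα))) ht
  have hL : (1 - w ^ p.toReal)⁻¹ * ((M : ℝ≥0∞) + 1) ^ p.toReal ≠ ∞ :=
    ENNReal.mul_ne_top (ENNReal.inv_ne_top.2 (tsub_pos_of_lt hw).ne') (by finiteness)
  have hlim := ENNReal.Tendsto.mul_const (ENNReal.tendsto_pow_atTop_nhds_zero_of_lt_one hw)
    (Or.inr hL)
  rw [zero_mul] at hlim
  obtain ⟨n, hn⟩ := (ENNReal.tendsto_nhds_zero.1 hlim ε hε).exists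
  refine ⟨(2 : ℝ) ^ (-(n : ℤ)), by positivity, fun u hu => ?_⟩
  have hu_lt : homBesovNorm d μ α p ∞ u < M + 1 :=
    hu.trans_lt (ENNReal.lt_add_right ENNReal.coe_ne_top one_ne_zero)
  simp only [homBesovNorm, lqNorm_top, iInf_lt_iff] at hu_lt
  obtain ⟨g, hg, hgM⟩ := hu_lt
  refine ⟨_, hg.hasOscillationBound hd hα.le n, le_trans ?_ hn⟩
  exact lintegral_iSup_pow_mul_rpow_le (g := fun j => g (n + j : ℕ)) ht (fun j => hg.1 _)
    (fun j => (eLpNorm_le_iff_lintegral_rpow_enorm_le hp0 hp).1 <|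
      (le_iSup (fun k => eLpNorm (g k) p μ) _).trans hgM.le) n

end FractionalGradient

/-- If `x ↦ μ (quasiBall d x r)` is not measurable, the integral in `hI` is the supremum of the
integrals of the measurable minorants of its integrand. -/
theorem mainTheorem3_general {X : Type*} [MeasurableSpace X] (d : X → X → ℝ) (μ ν : Measure X)
    (hX : IsQuasiMetricMeasureSpace d μ) (C : ℝ≥0) (hν : ν ≤ C • μ)
    (hI : ∀ r, 0 < r → ∫⁻ x, (μ (quasiBall d x r))⁻¹ ∂ν < ∞)
    (α : ℝ) (p q : ℝ≥0∞) (hα : 0 < α) (hp0 : 0 < p) (hp : p < ∞) (hq : 0 < q) :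
    TriebelLizorkinCompactlyEmbeds d μ ν α p q ∧
      BesovCompactlyEmbeds d μ ν α p q ∧
      HajlaszSobolevCompactlyEmbeds d μ ν α p := by
  have hBesov_top : BesovCompactlyEmbeds d μ ν α p ∞ :=
    isCompactlyEmbeddedInLp_of_hasOscillationBound hX hν hI hp0.ne' hp.ne fun M _ hε =>
      exists_hasOscillationBound_of_homBesovNorm_top_le hX.isQuasiMetric hα hp0.ne' hp.ne M hε
  exact ⟨hBesov_top.inhom_mono (homBesovNorm_top_le_homTriebelLizorkinNorm hq),
    hBesov_top.inhom_mono (homBesovNorm_top_le_homBesovNorm hq),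
    hBesov_top.inhom_mono homBesovNorm_top_le_homHajlaszSobolevNorm⟩

theorem mainTheorem3 {X : Type*} [Nonempty X] [MeasurableSpace X] (d : X → X → ℝ)
    (μ ν : Measure X) (hX : IsQuasiMetricMeasureSpace d μ)
    (C : ℝ≥0) (hν : ν ≤ C • μ) :
    (IsIntegrableMeasure d μ ν →
      ∀ (α : ℝ) (p q : ℝ≥0∞), 0 < α → 0 < p → p < ∞ → 0 < q →
        TriebelLizorkinCompactlyEmbeds d μ ν α p q ∧
        BesovCompactlyEmbeds d μ ν α p q ∧
        HajlaszSobolevCompactlyEmbeds d μ ν α p) ∧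
    (QuasiTotallyBounded d →
      ∀ (α : ℝ) (p q : ℝ≥0∞), 0 < α → 0 < p → p < ∞ → 0 < q →
        TriebelLizorkinCompactlyEmbeds d μ ν α p q ∧
        BesovCompactlyEmbeds d μ ν α p q ∧
        HajlaszSobolevCompactlyEmbeds d μ ν α p) :=
  ⟨fun hI => mainTheorem3_general d μ ν hX C hν fun _ => hI.lintegral_inv_measure_quasiBall_lt_top,
    fun hd => mainTheorem3_general d μ ν hX C hν fun _ =>
      hd.lintegral_inv_measure_quasiBall_lt_top hX hν⟩
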